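/- Let $k$ be a field, let $e\ge 4$, $q\ge 1$, $d\ge 1$ be integers, put $m=e+2q+1$ and assume $\gcd(m,d)=1$. Let $\Gamma=\Gamma_{(e,q,d)}(\mathcal S)\subseteq\mathbb N$ be the numerical semigroup generated by $$\mathcal S=\{m,\ m+d\}\cup\{(q+1)m+(q+i)d \;:\; 2\le i\le e-1\},$$ and let $R=k[[\Gamma]]\subseteq k[[t]]$ be the ring of all power series whose exponents lie in $\Gamma$, a local ring with maximal ideal $\mathfrak m$. Let $H(n)=\dim_{R/\mathfrak m}(\mathfrak m^n/\mathfrak m^{n+1})$, $n\ge 0$, be its Hilbert function. Then $R$ is a one-dimensional Gorenstein local ring (that is, $R$ is Noetherian of Krull dimension one, and $\mathfrak m$ contains a nonzerodivisor $x$ such that the ideal $xR$ is irreducible, i.e. proper and not an intersection of two strictly larger ideals), and $H$ is non-decreasing; so $R$ supports Rossi's conjecture, which asks whether the Hilbert function of a one-dimensional Gorenstein local ring is non-decreasing. Explicitly, $$H(0)=1,\qquad H(n)=\begin{cases} e+n-1, & 1\le n\le q+1,\\ e+q+1, & q+2\le n\le e+q,\\ n+1, & e+q+1\le n\le m-2,\\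 m, & n\ge m-1,\end{cases}$$ and the Hilbert series is, in $\mathbb Z[[t]]$, $\sum_{n\ge 0}H(n)t^n=\dfrac{f(t)}{1-t}$ with $$f(t)=(1-t)\Bigl(1+\sum_{i=1}^{q+1}(e+i-1)t^i+\sum_{i=q+2}^{e+q}(e+q+1)t^i+\sum_{i=e+q+1}^{m-2}(i+1)t^i\Bigr)+m\,t^{m-1}.$$ -/

import Mathlib

open scoped PowerSeries

/-- The Hilbert function of a local ring `R` with maximal ideal `𝔪` and residue field `κ = R / 𝔪`:
`n ↦ dim_κ (𝔪 ^ n / 𝔪 ^ (n + 1))`, where `𝔪 ^ (n + 1)` is written as the submodule `𝔪 • 𝔪 ^ n` of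
the `R`-module `𝔪 ^ n`. -/
noncomputable def hilbertFunction (R : Type*) [CommRing R] [IsLocalRing R] (n : ℕ) : ℕ :=
  Module.finrank (R ⧸ IsLocalRing.maximalIdeal R)
    (↥(IsLocalRing.maximalIdeal R ^ n) ⧸
      (IsLocalRing.maximalIdeal R • ⊤ : Submodule R ↥(IsLocalRing.maximalIdeal R ^ n)))

/-- The Hilbert series `∑ n, H_R(n) X ^ n` of a local ring. -/
noncomputable def hilbertSeries (R : Type*) [CommRing R] [IsLocalRing R] : ℤ⟦X⟧ :=
  PowerSeries.mk fun n => (hilbertFunction R n : ℤ)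

/-- A Gorenstein local ring of Krull dimension one: a Noetherian local ring of dimension one that
is Cohen-Macaulay (the maximal ideal contains a nonzerodivisor `x`) and in which a parameter ideal
`(x)` is irreducible, that is, proper and not an intersection of two strictly larger ideals.
(Equivalently, it is Cohen-Macaulay of type one.) -/
def IsGorensteinOfDimOne (R : Type*) [CommRing R] [IsLocalRing R] : Prop :=
  IsNoetherianRing R ∧ ringKrullDim R = 1 ∧
    ∃ x ∈ IsLocalRing.maximalIdeal R, x ∈ nonZeroDivisors R ∧ InfIrred (Ideal.span {x})

/-- The ring `k[[Γ]]` of an additive submonoid `Γ` of `ℕ`: the power series over `k` all of whose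
exponents lie in `Γ`. -/
def semigroupRing (k : Type*) [Field k] (Γ : AddSubmonoid ℕ) : Subalgebra k k⟦X⟧ where
  carrier := {f | ∀ n, PowerSeries.coeff n f ≠ 0 → n ∈ Γ}
  mul_mem' := by
    intro f g hf hg n hn
    rw [PowerSeries.coeff_mul] at hn
    obtain ⟨p, hp, hne⟩ := Finset.exists_ne_zero_of_sum_ne_zero hn
    rw [← Finset.HasAntidiagonal.mem_antidiagonal.mp hp]
    exact Γ.add_mem (hf _ (left_ne_zero_of_mul hne)) (hg _ (right_ne_zero_of_mul hne))
  add_mem' := by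
    intro f g hf hg n hn
    by_cases h : PowerSeries.coeff n f = 0
    · refine hg n fun h' => hn ?_
      rw [map_add, h, h', add_zero]
    · exact hf n h
  algebraMap_mem' := by
    intro r n hn
    rw [PowerSeries.algebraMap_apply, PowerSeries.coeff_C] at hn
    by_cases h : n = 0
    · rw [h]
      exact Γ.zero_mem
    · simp [h] at hn

theorem semigroupRing_inv_mem {k : Type*} [Field k] {Γ : AddSubmonoid ℕ} {f : k⟦X⟧}
    (hf : f ∈ semigroupRing k Γ) : f⁻¹ ∈ semigroupRing k Γ := by
  intro n
  induction n using Nat.strong_induction_on with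
  | _ n ih =>
    intro hn
    rw [PowerSeries.coeff_inv] at hn
    by_cases h0 : n = 0
    · rw [h0]
      exact Γ.zero_mem
    · rw [if_neg h0] at hn
      obtain ⟨p, hp, hne⟩ := Finset.exists_ne_zero_of_sum_ne_zero (right_ne_zero_of_mul hn)
      by_cases hlt : p.2 < n
      · rw [if_pos hlt] at hne
        rw [← Finset.HasAntidiagonal.mem_antidiagonal.mp hp]
        exact Γ.add_mem (hf _ (left_ne_zero_of_mul hne)) (ih _ hlt (right_ne_zero_of_mul hne))
      · rw [if_neg hlt] at hne
        exact absurd rfl hne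

theorem semigroupRing_isUnit {k : Type*} [Field k] {Γ : AddSubmonoid ℕ} (f : semigroupRing k Γ)
    (hf : PowerSeries.constantCoeff (f : k⟦X⟧) ≠ 0) : IsUnit f :=
  IsUnit.of_mul_eq_one (⟨(f : k⟦X⟧)⁻¹, semigroupRing_inv_mem f.2⟩ : semigroupRing k Γ)
    (Subtype.ext (PowerSeries.mul_inv_cancel (f : k⟦X⟧) hf))

instance semigroupRing_isLocalRing (k : Type*) [Field k] (Γ : AddSubmonoid ℕ) :
    IsLocalRing (semigroupRing k Γ) := by
  refine IsLocalRing.of_isUnit_or_isUnit_one_sub_self fun f => ?_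
  by_cases h : PowerSeries.constantCoeff (f : k⟦X⟧) = 0
  · right
    refine semigroupRing_isUnit _ ?_
    simp [h]
  · left
    exact semigroupRing_isUnit _ h

/-- The symmetric concatenation class: the submonoid of `ℕ` generated by `m`, `m + d` and
`(q + 1) m + (q + i) d` for `2 ≤ i ≤ e - 1`, where `m = e + 2 q + 1`. -/
def symmetricClass (e q d : ℕ) : AddSubmonoid ℕ :=
  AddSubmonoid.closure
    ({e + 2 * q + 1, e + 2 * q + 1 + d} ∪
      {x | ∃ i, 2 ≤ i ∧ i ≤ e - 1 ∧ x = (q + 1) * (e + 2 * q + 1) + (q + i) * d})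

/-!
Write `m = e + 2 q + 1`. Since `gcd (m, d) = 1`, every integer is uniquely `a m + b d` with
`0 ≤ b < m`. In these coordinates the semigroup `Γ` consists of the pairs with `b ≤ a + e - 2` and
(`b ≤ a` or `q + 1 ≤ a`). The number of nonzero summands into which such an element can be split is
at most `a`, attained when `b ≤ a` by using only `m` and `m + d`; when `a < b`, exactly one of
the large generators `(q + 1) m + (q + i) d` is needed, which costs `q`, and the maximum is `a - q`.
Trading `m d` for `d` copies of `m` shows that nothing is gained from representations with `b ≥ m`.
So the set `orderSet e q d n` of elements of order at least `n` is explicit. It is justified by a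
recursion: `orderSet e q d (n + 1)` consists of the sums of a generator and an element of
`orderSet e q d n` (`generator_add_mem_orderSet`, `exists_generator_of_mem_orderSet`).

A power series whose exponents lie in `S + I`, with `S` finite, is a combination of the monomials
`t ^ s`, `s ∈ S`, with coefficients supported in `I` (`exists_eq_sum_X_pow_mul`). Hence `𝔪 ^ n` is
the monomial ideal of `orderSet e q d n` (`maximalIdeal_pow`), and `H n` is the number of elements
of order exactly `n` (`hilbertFunction_eq_card`). For fixed `n` there is one such element for each
`b ≤ n` and, if `n ≥ 1`, one for each `b` with `n + q < b ≤ n + q + e - 2`, always with `b < m`;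
counting them gives the values of `H`, and the series follows coefficientwise.

Since `Γ` contains all large integers, a nonzero series in `k[[Γ]]` divides a power of every element
of `𝔪`, so the only primes are `0` and `𝔪`; as `𝔪` is finitely generated, Cohen's theorem gives
Noetherianity, and the dimension is one. Finally the Apéry set of `Γ` with respect to `m` is
symmetric under `w ↦ w₀ - w`, where `w₀ = (2 q + 2) m + (e + 2 q) d` is its largest element
(`exists_add_eq_aperyMax`). Therefore `t ^ w₀` lies in every ideal strictly containing `(t ^ m)` but
not in `(t ^ m)` itself, so that ideal is irreducible.
-/

universe u

/-! ### Normal forms in the numerical semigroup -/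

/-- The set of the `a m + b d` with `m = e + 2 q + 1` and `b < m` such that `(a, b)` lies above the
Apéry function, that is `b ≤ a + e - 2` and (`b ≤ a` or `q + 1 ≤ a`), and such that the order of
`(a, b)`, which is `a` when `b ≤ a` and `a - q` otherwise, is at least `n`. -/
def orderSet (e q d n : ℕ) : Set ℕ :=
  {x | ∃ a b, b < e + 2 * q + 1 ∧ b + 2 ≤ a + e ∧ (b ≤ a ∨ q + 1 ≤ a) ∧
    (b ≤ a ∧ n ≤ a ∨ n + q ≤ a) ∧ x = a * (e + 2 * q + 1) + b * d}

/-- The generators of `symmetricClass e q d`. -/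
def symmetricGenerators (e q d : ℕ) : Set ℕ :=
  {e + 2 * q + 1, e + 2 * q + 1 + d} ∪
    {x | ∃ i, 2 ≤ i ∧ i ≤ e - 1 ∧ x = (q + 1) * (e + 2 * q + 1) + (q + i) * d}

theorem symmetricGenerators_finite (e q d : ℕ) : (symmetricGenerators e q d).Finite := by
  refine (Set.toFinite _).union (((Set.finite_Iic (e - 1)).image
    fun i => (q + 1) * (e + 2 * q + 1) + (q + i) * d).subset ?_)
  rintro x ⟨i, -, hi, rfl⟩
  exact ⟨i, hi, rfl⟩

theorem pos_of_mem_symmetricGenerators {e q d s : ℕ} (hs : s ∈ symmetricGenerators e q d) :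
    0 < s := by
  rcases hs with (rfl | rfl) | ⟨i, -, -, rfl⟩ <;> positivity

theorem add_mul_inj {m d a b a' b' : ℕ} (hmd : Nat.gcd m d = 1) (hb : b < m) (hb' : b' < m)
    (h : a * m + b * d = a' * m + b' * d) : a = a' ∧ b = b' := by
  have h1 : b * d ≡ b' * d [MOD m] := by
    have h2 := congrArg (· % m) h
    simpa [Nat.ModEq, Nat.add_mod] using h2
  have h2 : b = b' := (Nat.ModEq.cancel_right_of_coprime hmd h1).eq_of_lt_of_lt hb hb'
  subst h2
  exact ⟨Nat.eq_of_mul_eq_mul_right (by omega) (Nat.add_right_cancel h), rfl⟩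

theorem mem_orderSet_iff {e q d n a b : ℕ} (hmd : Nat.gcd (e + 2 * q + 1) d = 1)
    (hb : b < e + 2 * q + 1) :
    a * (e + 2 * q + 1) + b * d ∈ orderSet e q d n ↔
      b + 2 ≤ a + e ∧ (b ≤ a ∨ q + 1 ≤ a) ∧ (b ≤ a ∧ n ≤ a ∨ n + q ≤ a) := by
  constructor
  · rintro ⟨a', b', hb', h1, h2, h3, h⟩
    obtain ⟨rfl, rfl⟩ := add_mul_inj hmd hb hb' h
    exact ⟨h1, h2, h3⟩
  · rintro ⟨h1, h2, h3⟩
    exact ⟨a, b, hb, h1, h2, h3, rfl⟩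

theorem orderSet_antitone (e q d : ℕ) : Antitone (orderSet e q d) := by
  rintro n n' hn x ⟨a, b, hb, h1, h2, h3, rfl⟩
  exact ⟨a, b, hb, h1, h2, by omega, rfl⟩

theorem generator_add_mem_orderSet {e q d n s x : ℕ} (he : 2 ≤ e) (hd : 0 < d)
    (hs : s ∈ symmetricGenerators e q d) (hx : x ∈ orderSet e q d n) :
    s + x ∈ orderSet e q d (n + 1) := by
  obtain ⟨a, b, hb, h1, h2, h3, rfl⟩ := hx
  rcases hs with (rfl | rfl) | ⟨i, hi, hi', rfl⟩
  · exact ⟨a + 1, b, hb, by omega, by omega, by omega, by ring⟩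
  · rcases Nat.lt_or_ge (b + 1) (e + 2 * q + 1) with h | h
    · exact ⟨a + 1, b + 1, h, by omega, by omega, by omega, by ring⟩
    · obtain rfl : b = e + 2 * q := by omega
      exact ⟨a + 1 + d, 0, by omega, by omega, by omega, by omega, by ring⟩
  · rcases Nat.lt_or_ge (b + q + i) (e + 2 * q + 1) with h | h
    · exact ⟨a + q + 1, b + q + i, h, by omega, by omega, by omega, by ring⟩
    · -- the `d`-coordinate passes `m`, and `m d` is traded for `d` copies of `m`
      obtain ⟨c, hc⟩ : ∃ c, b + q + i = c + (e + 2 * q + 1) := ⟨_, (Nat.sub_add_cancel h).symm⟩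
      refine ⟨a + q + 1 + d, c, by omega, by omega, by omega, by omega, ?_⟩
      linarith [congrArg (· * d) hc]

theorem exists_generator_of_mem_orderSet {e q d n x : ℕ} (he : 2 ≤ e)
    (hx : x ∈ orderSet e q d (n + 1)) :
    ∃ s ∈ symmetricGenerators e q d, ∃ y ∈ orderSet e q d n, x = s + y := by
  obtain ⟨a, b, hb, h1, h2, h3, rfl⟩ := hx
  rcases Nat.eq_zero_or_pos b with rfl | hb0
  · obtain ⟨a, rfl⟩ : ∃ c, a = c + 1 := ⟨a - 1, by omega⟩
    exact ⟨_, Or.inl (Or.inl rfl), _,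
      ⟨a, 0, hb, by omega, by omega, by omega, rfl⟩, by ring⟩
  -- subtract `m + d`, except from an element that is itself a large generator
  by_cases h : b ≤ a ∨ q + 2 ≤ a
  · obtain ⟨a, rfl⟩ : ∃ c, a = c + 1 := ⟨a - 1, by omega⟩
    obtain ⟨b, rfl⟩ : ∃ c, b = c + 1 := ⟨b - 1, by omega⟩
    exact ⟨_, Or.inl (Or.inr rfl), _,
      ⟨a, b, by omega, by omega, by omega, by omega, rfl⟩, by ring⟩
  · obtain rfl : a = q + 1 := by omega
    obtain ⟨i, rfl⟩ : ∃ i, b = q + i := ⟨b - q, by omega⟩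
    exact ⟨_, Or.inr ⟨i, by omega, by omega, rfl⟩, _,
      ⟨0, 0, by omega, by omega, by omega, by omega, rfl⟩, by ring⟩

theorem zero_mem_orderSet {e q d : ℕ} (he : 2 ≤ e) : 0 ∈ orderSet e q d 0 :=
  ⟨0, 0, by omega, by omega, by omega, by omega, by simp⟩

theorem orderSet_one {e q d x : ℕ} (hx : x ∈ orderSet e q d 0) (hx0 : x ≠ 0) :
    x ∈ orderSet e q d 1 := by
  obtain ⟨a, b, hb, h1, h2, h3, rfl⟩ := hx
  refine ⟨a, b, hb, h1, h2, ?_, rfl⟩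
  rcases Nat.eq_zero_or_pos a with rfl | ha
  · obtain rfl : b = 0 := by omega
    simp at hx0
  · omega

theorem mem_symmetricClass_iff {e q d : ℕ} (he : 2 ≤ e) (hd : 0 < d) {x : ℕ} :
    x ∈ symmetricClass e q d ↔ x ∈ orderSet e q d 0 := by
  constructor
  · intro hx
    change x ∈ AddSubmonoid.closure (symmetricGenerators e q d) at hx
    induction hx using AddSubmonoid.closure_induction_left with
    | zero => exact zero_mem_orderSet he
    | add_left s hs y hy ih =>
      exact orderSet_antitone e q d (Nat.zero_le 1) (generator_add_mem_orderSet he hd hs ih)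
  · induction x using Nat.strong_induction_on with
    | _ x ih =>
      intro hx
      by_cases hx0 : x = 0
      · rw [hx0]
        exact zero_mem _
      · obtain ⟨s, hs, y, hy, rfl⟩ := exists_generator_of_mem_orderSet he (orderSet_one hx hx0)
        have := pos_of_mem_symmetricGenerators hs
        exact add_mem (AddSubmonoid.subset_closure hs) (ih y (by omega) hy)

theorem generator_mem_symmetricClass {e q d s : ℕ} (hs : s ∈ symmetricGenerators e q d) :
    s ∈ symmetricClass e q d :=
  AddSubmonoid.subset_closure hs

theorem add_mem_orderSet {e q d n x s : ℕ} (he : 2 ≤ e) (hd : 0 < d)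
    (hx : x ∈ orderSet e q d n) (hs : s ∈ symmetricClass e q d) : x + s ∈ orderSet e q d n := by
  change s ∈ AddSubmonoid.closure (symmetricGenerators e q d) at hs
  induction hs using AddSubmonoid.closure_induction_left with
  | zero => exact hx
  | add_left s hs y hy ih =>
    rw [add_left_comm]
    exact orderSet_antitone e q d n.le_succ (generator_add_mem_orderSet he hd hs ih)

/-! ### Counting the elements of given order -/

/-- The possible second coordinates `b` of an element of order `n`: the first coordinate is then
`n` if `b ≤ n`, and `n + q` if `n + q < b`. -/
def orderIndices (e q n : ℕ) : Finset ℕ :=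
  {b ∈ Finset.range (e + 2 * q + 1) | b ≤ n ∨ 1 ≤ n ∧ n + q < b ∧ b + 2 ≤ n + q + e}

theorem exists_finset_orderSet_diff {e q d n : ℕ} (he : 2 ≤ e)
    (hmd : Nat.gcd (e + 2 * q + 1) d = 1) :
    ∃ D : Finset ℕ, (D : Set ℕ) = orderSet e q d n \ orderSet e q d (n + 1) ∧
      D.card = (orderIndices e q n).card := by
  refine ⟨(orderIndices e q n).image
    fun b => (if b ≤ n then n else n + q) * (e + 2 * q + 1) + b * d, ?_, ?_⟩
  · ext x
    simp only [Finset.coe_image, Set.mem_image, Finset.mem_coe, orderIndices, Finset.mem_filter,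
      Finset.mem_range, Set.mem_sdiff]
    constructor
    · rintro ⟨b, ⟨hb, h⟩, rfl⟩
      rw [mem_orderSet_iff hmd hb, mem_orderSet_iff hmd hb]
      split_ifs <;> omega
    · rintro ⟨⟨a, b, hb, h1, h2, h3, rfl⟩, h⟩
      rw [mem_orderSet_iff hmd hb] at h
      refine ⟨b, ⟨hb, by omega⟩, ?_⟩
      congr 2
      split_ifs <;> omega
  · refine Finset.card_image_of_injOn fun b hb b' hb' h => ?_
    simp only [orderIndices, Finset.coe_filter, Finset.mem_range, Set.mem_ofPred_eq] at hb hb'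
    exact (add_mul_inj hmd hb.1 hb'.1 h).2

theorem card_orderIndices {e q n : ℕ} :
    (orderIndices e q n).card = min (n + 1) (e + 2 * q + 1) +
      (if n = 0 then 0 else min (e + q - n) (e - 2)) := by
  have h : orderIndices e q n = Finset.range (min (n + 1) (e + 2 * q + 1)) ∪
      (if n = 0 then ∅ else
        Finset.Ico (n + q + 1) (n + q + 1 + min (e + q - n) (e - 2))) := by
    ext b
    split_ifs <;>
    · simp [orderIndices]
      omega
  rw [h, Finset.card_union_of_disjoint, Finset.card_range]
  · split_ifs <;> simp
  · rw [Finset.disjoint_left]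
    intro b
    split_ifs <;>
    · simp
      try omega

/-! ### Conductor and symmetry -/

theorem exists_conductor {e q d : ℕ} (he : 2 ≤ e) (hd : 0 < d)
    (hmd : Nat.gcd (e + 2 * q + 1) d = 1) : ∃ c, ∀ n, c ≤ n → n ∈ symmetricClass e q d := by
  refine ⟨(2 * q + 2 + d) * (e + 2 * q + 1), fun n hn => ?_⟩
  obtain ⟨b, hb, h⟩ := Nat.exists_mul_mod_eq_of_coprime (k := e + 2 * q + 1) (n := d) n
    (Nat.Coprime.symm hmd) (by omega)
  have hbd : b * d ≤ d * (e + 2 * q + 1) := by nlinarith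
  have hle : (2 * q + 2) * (e + 2 * q + 1) + b * d ≤ n := by linarith
  obtain ⟨a, ha⟩ : e + 2 * q + 1 ∣ n - b * d :=
    (Nat.modEq_iff_dvd' (by omega)).1 (by rw [mul_comm b]; exact h)
  have hn' : n = a * (e + 2 * q + 1) + b * d := by
    have : n = (e + 2 * q + 1) * a + b * d := by omega
    linarith
  have ha' : 2 * q + 2 ≤ a := by
    by_contra hlt
    nlinarith
  rw [mem_symmetricClass_iff he hd, hn', mem_orderSet_iff hmd hb]
  omega

/-- The largest element `F + m` of the Apéry set of `symmetricClass e q d` with respect to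
`m = e + 2 q + 1`, where `F` is the Frobenius number. -/
def aperyMax (e q d : ℕ) : ℕ := (2 * q + 2) * (e + 2 * q + 1) + (e + 2 * q) * d

theorem aperyMax_mem {e q d : ℕ} (he : 2 ≤ e) (hd : 0 < d) :
    aperyMax e q d ∈ symmetricClass e q d :=
  (mem_symmetricClass_iff he hd).2 ⟨_, _, by omega, by omega, by omega, by omega, rfl⟩

theorem aperyMax_ne_add {e q d y : ℕ} (he : 2 ≤ e) (hd : 0 < d)
    (hmd : Nat.gcd (e + 2 * q + 1) d = 1) (hy : y ∈ symmetricClass e q d) :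
    aperyMax e q d ≠ e + 2 * q + 1 + y := by
  rw [mem_symmetricClass_iff he hd] at hy
  obtain ⟨a, b, hb, h1, h2, h3, rfl⟩ := hy
  intro h
  have h' : (2 * q + 2) * (e + 2 * q + 1) + (e + 2 * q) * d
      = (a + 1) * (e + 2 * q + 1) + b * d := by
    rw [← aperyMax, h]
    ring
  have := add_mul_inj hmd (by omega) hb h'
  omega

/-- The symmetry of the semigroup: its Apéry set is stable under `w ↦ aperyMax e q d - w`. -/
theorem exists_add_eq_aperyMax {e q d x : ℕ} (he : 2 ≤ e) (hd : 0 < d)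
    (hx : x ∈ symmetricClass e q d)
    (hx' : ∀ y ∈ symmetricClass e q d, x ≠ e + 2 * q + 1 + y) :
    ∃ z ∈ symmetricClass e q d, x + z = aperyMax e q d := by
  rw [mem_symmetricClass_iff he hd] at hx
  obtain ⟨a, b, hb, h1, h2, h3, rfl⟩ := hx
  have key : a = 0 ∨ ¬ (b + 2 ≤ a - 1 + e ∧ (b ≤ a - 1 ∨ q + 1 ≤ a - 1)) := by
    by_contra! hcon
    obtain ⟨a, rfl⟩ : ∃ c, a = c + 1 := ⟨a - 1, by omega⟩
    refine hx' (a * (e + 2 * q + 1) + b * d) ((mem_symmetricClass_iff he hd).2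
      ⟨a, b, hb, hcon.2.1, hcon.2.2, by omega, rfl⟩) (by ring)
  obtain ⟨a', ha'⟩ : ∃ c, a + c = 2 * q + 2 := ⟨2 * q + 2 - a, by omega⟩
  obtain ⟨b', hb'⟩ : ∃ c, b + c = e + 2 * q := ⟨e + 2 * q - b, by omega⟩
  refine ⟨a' * (e + 2 * q + 1) + b' * d, (mem_symmetricClass_iff he hd).2
    ⟨a', b', by omega, by omega, by omega, by omega, rfl⟩, ?_⟩
  rw [aperyMax, ← ha', ← hb']
  ring

/-! ### Monomial ideals of semigroup rings -/

section SemigroupRing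

variable {k : Type*} [Field k] {Γ : AddSubmonoid ℕ}

/-- The ideal of `k[[Γ]]` of all series whose exponents lie in `I`, a set of exponents stable under
adding elements of `Γ`. Only the exponents in `I ∩ Γ` matter. -/
def monomialIdeal (k : Type*) [Field k] (Γ : AddSubmonoid ℕ) (I : Set ℕ)
    (hI : ∀ a ∈ I, ∀ s ∈ Γ, a + s ∈ I) : Ideal (semigroupRing k Γ) where
  carrier := {f | ∀ n, PowerSeries.coeff n (f : k⟦X⟧) ≠ 0 → n ∈ I}
  zero_mem' := by
    intro n hn
    simp at hn
  add_mem' := by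
    intro f g hf hg n hn
    by_cases h : PowerSeries.coeff n (f : k⟦X⟧) = 0
    · refine hg n fun h' => hn ?_
      simp [h, h']
    · exact hf n h
  smul_mem' := by
    intro c f hf n hn
    rw [smul_eq_mul, MulMemClass.coe_mul, PowerSeries.coeff_mul] at hn
    obtain ⟨p, hp, hne⟩ := Finset.exists_ne_zero_of_sum_ne_zero hn
    rw [← Finset.HasAntidiagonal.mem_antidiagonal.mp hp, add_comm]
    exact hI _ (hf _ (right_ne_zero_of_mul hne)) _ (c.2 _ (left_ne_zero_of_mul hne))

theorem X_pow_mem_semigroupRing {s : ℕ} (hs : s ∈ Γ) :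
    (PowerSeries.X ^ s : k⟦X⟧) ∈ semigroupRing k Γ := by
  intro n hn
  rw [PowerSeries.coeff_X_pow] at hn
  rwa [(ite_ne_right_iff.1 hn).1]

/-- The monomial `t ^ s` in `k[[Γ]]`, for `s ∈ Γ`. -/
noncomputable def semigroupMonomial (k : Type*) [Field k] {Γ : AddSubmonoid ℕ} {s : ℕ}
    (hs : s ∈ Γ) : semigroupRing k Γ :=
  ⟨PowerSeries.X ^ s, X_pow_mem_semigroupRing hs⟩

theorem coe_semigroupMonomial {s : ℕ} (hs : s ∈ Γ) :
    (semigroupMonomial k hs : k⟦X⟧) = PowerSeries.X ^ s :=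
  rfl

/-- A power series with exponents in `S + I`, where `S` is finite, is a combination of the
monomials `t ^ s`, `s ∈ S`, with coefficients having exponents in `I`. -/
theorem exists_eq_sum_X_pow_mul (S : Finset ℕ) (I : Set ℕ) (f : k⟦X⟧)
    (hf : ∀ n, PowerSeries.coeff n f ≠ 0 → ∃ s ∈ S, ∃ y ∈ I, n = s + y) :
    ∃ g : ℕ → k⟦X⟧, (∀ s n, PowerSeries.coeff n (g s) ≠ 0 → n ∈ I) ∧
      f = ∑ s ∈ S, PowerSeries.X ^ s * g s := by
  classical
  -- each exponent `n` of `f` is assigned to one summand `σ n` of `S`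
  choose! σ hσ y hy hn using hf
  refine ⟨fun s => PowerSeries.mk fun n =>
    if σ (n + s) = s then PowerSeries.coeff (n + s) f else 0, fun s n h => ?_, ?_⟩
  · rw [PowerSeries.coeff_mk] at h
    obtain ⟨h1, h2⟩ := ite_ne_right_iff.1 h
    have h3 := hn _ h2
    rw [h1] at h3
    have h4 : n = y (n + s) := by omega
    rw [h4]
    exact hy _ h2
  · ext n
    rw [map_sum]
    simp_rw [PowerSeries.coeff_X_pow_mul', PowerSeries.coeff_mk]
    by_cases h0 : PowerSeries.coeff n f = 0
    · rw [h0]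
      refine (Finset.sum_eq_zero fun s _ => ?_).symm
      split_ifs with h1 h2
      · rw [Nat.sub_add_cancel h1, h0]
      · rfl
      · rfl
    · have hle : σ n ≤ n := by
        have := hn n h0
        omega
      rw [Finset.sum_eq_single_of_mem (σ n) (hσ n h0)]
      · rw [if_pos hle, Nat.sub_add_cancel hle, if_pos rfl]
      · intro s _ hs
        split_ifs with h1 h2
        · rw [Nat.sub_add_cancel h1] at h2
          exact absurd h2.symm hs
        · rfl
        · rfl

/-- The maximal ideal consists of the series with zero constant coefficient. -/
theorem mem_maximalIdeal_semigroupRing {f : semigroupRing k Γ} :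
    f ∈ IsLocalRing.maximalIdeal (semigroupRing k Γ) ↔
      PowerSeries.constantCoeff (f : k⟦X⟧) = 0 := by
  rw [IsLocalRing.mem_maximalIdeal, mem_nonunits_iff, ← not_iff_not, not_not]
  refine ⟨fun h => ?_, semigroupRing_isUnit f⟩
  have h1 := h.map (PowerSeries.constantCoeff.comp (semigroupRing k Γ).val.toRingHom)
  exact h1.ne_zero

theorem semigroupMonomial_mem_maximalIdeal {s : ℕ} (hs : s ∈ Γ) (hs0 : s ≠ 0) :
    semigroupMonomial k hs ∈ IsLocalRing.maximalIdeal (semigroupRing k Γ) := by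
  rw [mem_maximalIdeal_semigroupRing, coe_semigroupMonomial, map_pow,
    PowerSeries.constantCoeff_X, zero_pow hs0]

/-- If the exponents of `f` lie in `S + I`, then `f` lies in the product with `𝔪` of the monomial
ideal of `I`. -/
theorem mem_maximalIdeal_mul {S : Finset ℕ} (hS : ∀ s ∈ S, s ∈ Γ ∧ s ≠ 0) {I : Set ℕ}
    (hI : ∀ a ∈ I, ∀ s ∈ Γ, a + s ∈ I) (hIΓ : I ⊆ Γ) {f : semigroupRing k Γ}
    (hf : ∀ n, PowerSeries.coeff n (f : k⟦X⟧) ≠ 0 → ∃ s ∈ S, ∃ y ∈ I, n = s + y) :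
    f ∈ IsLocalRing.maximalIdeal (semigroupRing k Γ) * monomialIdeal k Γ I hI := by
  obtain ⟨g, hg, hfg⟩ := exists_eq_sum_X_pow_mul S I _ hf
  have h : f = ∑ s ∈ S.attach, semigroupMonomial k (hS s.1 s.2).1 *
      ⟨g s.1, fun n hn => hIΓ (hg s.1 n hn)⟩ := by
    apply Subtype.ext
    rw [hfg, AddSubmonoidClass.coe_finsetSum, ← Finset.sum_attach]
    rfl
  rw [h]
  exact Ideal.sum_mem _ fun s _ => Ideal.mul_mem_mul
    (semigroupMonomial_mem_maximalIdeal _ (hS s.1 s.2).2) (hg s.1)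

/-! ### Noetherianity, dimension, and irreducibility of a parameter ideal -/

theorem maximalIdeal_semigroupRing_fg {S : Finset ℕ} (hS : ∀ s ∈ S, s ∈ Γ ∧ s ≠ 0)
    (hΓ : ∀ n ∈ Γ, n ≠ 0 → ∃ s ∈ S, ∃ y ∈ Γ, n = s + y) :
    (IsLocalRing.maximalIdeal (semigroupRing k Γ)).FG := by
  classical
  refine ⟨S.attach.image fun s => semigroupMonomial k (hS s.1 s.2).1, le_antisymm ?_ ?_⟩
  · refine Ideal.span_le.2 fun f hf => ?_
    simp only [Finset.coe_image, Set.mem_image, Finset.mem_coe] at hf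
    obtain ⟨s, -, rfl⟩ := hf
    exact semigroupMonomial_mem_maximalIdeal _ (hS s.1 s.2).2
  · intro f hf
    rw [mem_maximalIdeal_semigroupRing] at hf
    obtain ⟨g, hg, hfg⟩ := exists_eq_sum_X_pow_mul S Γ (f : k⟦X⟧) fun n hn =>
      hΓ n (f.2 n hn) fun h0 => hn (by rwa [h0, PowerSeries.coeff_zero_eq_constantCoeff_apply])
    have h : f = ∑ s ∈ S.attach, ⟨g s.1, hg s.1⟩ * semigroupMonomial k (hS s.1 s.2).1 := by
      apply Subtype.ext
      rw [hfg, AddSubmonoidClass.coe_finsetSum, ← Finset.sum_attach]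
      exact Finset.sum_congr rfl fun s _ => mul_comm _ _
    rw [h]
    exact Ideal.sum_mem _ fun s _ => Ideal.mul_mem_left _ _
      (Ideal.subset_span (Finset.mem_image_of_mem _ (Finset.mem_attach _ s)))

/-- If `Γ` has a conductor `c`, then a nonzero `f` of order `a` divides every series of order at
least `a + c`, in particular high powers of all elements of `𝔪`. -/
theorem maximalIdeal_le_of_isPrime {c : ℕ} (hc : ∀ n, c ≤ n → n ∈ Γ)
    {P : Ideal (semigroupRing k Γ)} (hP : P.IsPrime) (hP0 : P ≠ ⊥) :
    IsLocalRing.maximalIdeal (semigroupRing k Γ) ≤ P := by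
  obtain ⟨f, hfP, hf0⟩ := Submodule.exists_mem_ne_zero_of_ne_bot hP0
  have hf0' : (f : k⟦X⟧) ≠ 0 := fun h => hf0 (Subtype.ext h)
  obtain ⟨u, hu⟩ := (PowerSeries.isUnit_divided_by_X_pow_order hf0').exists_right_inv
  set a := (f : k⟦X⟧).order.toNat
  have hfu : (f : k⟦X⟧) * u = PowerSeries.X ^ a := by
    rw [← PowerSeries.X_pow_order_mul_divXPowOrder (f := (f : k⟦X⟧)), mul_assoc, hu, mul_one]
  intro g hg
  rw [mem_maximalIdeal_semigroupRing, ← PowerSeries.X_dvd_iff] at hg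
  obtain ⟨g', hg'⟩ := hg
  have hh : PowerSeries.X ^ c * (u * g' ^ (a + c)) ∈ semigroupRing k Γ := by
    intro n hn
    rw [PowerSeries.coeff_X_pow_mul'] at hn
    exact hc n (ite_ne_right_iff.1 hn).1
  have hgf : g ^ (a + c) = f * ⟨_, hh⟩ := by
    apply Subtype.ext
    calc (g : k⟦X⟧) ^ (a + c) = PowerSeries.X ^ a * PowerSeries.X ^ c * g' ^ (a + c) := by
          rw [hg', mul_pow, pow_add]
      _ = (f : k⟦X⟧) * (PowerSeries.X ^ c * (u * g' ^ (a + c))) := by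
          rw [← hfu]
          ring
  refine hP.mem_of_pow_mem (a + c) ?_
  rw [hgf]
  exact P.mul_mem_right _ hfP

theorem eq_maximalIdeal_of_isPrime {c : ℕ} (hc : ∀ n, c ≤ n → n ∈ Γ)
    {P : Ideal (semigroupRing k Γ)} (hP : P.IsPrime) (hP0 : P ≠ ⊥) :
    P = IsLocalRing.maximalIdeal (semigroupRing k Γ) :=
  le_antisymm (IsLocalRing.le_maximalIdeal hP.ne_top) (maximalIdeal_le_of_isPrime hc hP hP0)

/-- By Cohen's theorem, since the only primes are `0` and `𝔪`. -/
theorem isNoetherianRing_semigroupRing {c : ℕ} (hc : ∀ n, c ≤ n → n ∈ Γ) {S : Finset ℕ}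
    (hS : ∀ s ∈ S, s ∈ Γ ∧ s ≠ 0) (hΓ : ∀ n ∈ Γ, n ≠ 0 → ∃ s ∈ S, ∃ y ∈ Γ, n = s + y) :
    IsNoetherianRing (semigroupRing k Γ) := by
  refine IsNoetherianRing.of_prime fun P hP => ?_
  by_cases hP0 : P = ⊥
  · rw [hP0]
    exact Submodule.fg_bot
  · rw [eq_maximalIdeal_of_isPrime hc hP hP0]
    exact maximalIdeal_semigroupRing_fg hS hΓ

theorem ringKrullDim_semigroupRing {c : ℕ} (hc : ∀ n, c ≤ n → n ∈ Γ) :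
    ringKrullDim (semigroupRing k Γ) = 1 := by
  have h1 : Ring.KrullDimLE 1 (semigroupRing k Γ) := Ring.KrullDimLE.mk₁' fun P hP0 hP => by
    rw [eq_maximalIdeal_of_isPrime hc hP hP0]
    infer_instance
  refine le_antisymm (Ring.krullDimLE_iff.1 h1) ?_
  by_contra hlt
  have h0 : Ring.KrullDimLE 0 (semigroupRing k Γ) := by
    rw [Ring.krullDimLE_iff, ← ENat.WithBot.lt_add_one_iff, Nat.cast_zero, zero_add]
    exact not_le.1 hlt
  have hfield := Ring.KrullDimLE.isField_of_isDomain (R := semigroupRing k Γ)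
  have hmem := semigroupMonomial_mem_maximalIdeal (k := k) (hc (c + 1) (by omega)) (by omega)
  rw [IsLocalRing.isField_iff_maximalIdeal_eq.1 hfield, Ideal.mem_bot] at hmem
  exact pow_ne_zero (c + 1) (PowerSeries.X_ne_zero (R := k)) (congrArg Subtype.val hmem)

theorem mem_span_semigroupMonomial_iff {m : ℕ} (hm : m ∈ Γ) {f : semigroupRing k Γ} :
    f ∈ Ideal.span {semigroupMonomial k hm} ↔
      ∀ n, PowerSeries.coeff n (f : k⟦X⟧) ≠ 0 → ∃ y ∈ Γ, n = m + y := by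
  rw [Ideal.mem_span_singleton]
  constructor
  · rintro ⟨g, rfl⟩ n hn
    rw [MulMemClass.coe_mul, coe_semigroupMonomial, PowerSeries.coeff_X_pow_mul'] at hn
    obtain ⟨h1, h2⟩ := ite_ne_right_iff.1 hn
    exact ⟨n - m, g.2 _ h2, by omega⟩
  · intro h
    obtain ⟨g, hg, hfg⟩ := exists_eq_sum_X_pow_mul {m} Γ (f : k⟦X⟧) (by simpa using h)
    exact ⟨⟨g m, hg m⟩, Subtype.ext (by
      rw [hfg, Finset.sum_singleton]
      rfl)⟩

/-- Let `w` be an element of the Apéry set of `Γ` with respect to `m` such that `w - x` lies in `Γ`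
for every other element `x` of the Apéry set. Then `t ^ w` lies in every ideal that strictly
contains `(t ^ m)`: multiply an element by the monomial that moves the first exponent outside
`m + Γ` to `w`. -/
theorem semigroupMonomial_mem_of_lt {m w : ℕ} (hm : m ∈ Γ) (hw : w ∈ Γ)
    (hsymm : ∀ x ∈ Γ, (∀ y ∈ Γ, x ≠ m + y) → ∃ z ∈ Γ, x + z = w)
    {I : Ideal (semigroupRing k Γ)} (hI : Ideal.span {semigroupMonomial k hm} < I) :
    semigroupMonomial k hw ∈ I := by
  classical
  obtain ⟨f, hfI, hf⟩ := SetLike.exists_of_lt hI |>.imp fun f h => h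
  rw [mem_span_semigroupMonomial_iff] at hf
  push Not at hf
  set x := Nat.find hf with hx
  obtain ⟨hx0, hxm⟩ := Nat.find_spec hf
  rw [← hx] at hx0 hxm
  have hmin : ∀ n < x, PowerSeries.coeff n (f : k⟦X⟧) ≠ 0 → ∃ y ∈ Γ, n = m + y := by
    intro n hn h0
    have := Nat.find_min hf hn
    push Not at this
    exact this h0
  obtain ⟨z, hz, hxz⟩ := hsymm x (f.2 x hx0) hxm
  have hdiff : f * semigroupMonomial k hz
      - algebraMap k _ (PowerSeries.coeff x (f : k⟦X⟧)) * semigroupMonomial k hw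
      ∈ Ideal.span {semigroupMonomial k hm} := by
    rw [mem_span_semigroupMonomial_iff]
    intro n hn
    have hcoe : (algebraMap k (semigroupRing k Γ) (PowerSeries.coeff x (f : k⟦X⟧)) : k⟦X⟧)
        = PowerSeries.C (PowerSeries.coeff x (f : k⟦X⟧)) := rfl
    rw [AddSubgroupClass.coe_sub, MulMemClass.coe_mul, MulMemClass.coe_mul, hcoe,
      coe_semigroupMonomial, coe_semigroupMonomial, map_sub, PowerSeries.coeff_mul_X_pow',
      PowerSeries.coeff_C_mul, PowerSeries.coeff_X_pow] at hn
    by_cases hnw : n = w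
    · refine absurd ?_ hn
      rw [if_pos (by omega), if_pos hnw, show n - z = x by omega]
      ring
    · rw [if_neg hnw, mul_zero, sub_zero] at hn
      obtain ⟨hzn, h0⟩ := ite_ne_right_iff.1 hn
      by_contra! hcon
      have hnΓ : n ∈ Γ := by
        have := add_mem (f.2 _ h0) hz
        rwa [Nat.sub_add_cancel hzn] at this
      obtain ⟨z', -, hz'⟩ := hsymm n hnΓ hcon
      obtain ⟨y, hy, hny⟩ := hmin (n - z) (by omega) h0
      exact hcon (y + z) (add_mem hy hz) (by omega)
  have h2 : algebraMap k (semigroupRing k Γ) (PowerSeries.coeff x (f : k⟦X⟧)) *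
      semigroupMonomial k hw ∈ I := by
    have := I.sub_mem (I.mul_mem_right (semigroupMonomial k hz) hfI) (hI.le hdiff)
    rwa [sub_sub_cancel] at this
  exact (I.unit_mul_mem_iff_mem ((IsUnit.mk0 _ hx0).map _)).1 h2

theorem infIrred_span_semigroupMonomial {m w : ℕ} (hm : m ∈ Γ) (hw : w ∈ Γ)
    (hwm : ∀ y ∈ Γ, w ≠ m + y)
    (hsymm : ∀ x ∈ Γ, (∀ y ∈ Γ, x ≠ m + y) → ∃ z ∈ Γ, x + z = w) :
    InfIrred (Ideal.span {semigroupMonomial k hm}) := by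
  have hnot : semigroupMonomial k hw ∉ Ideal.span {semigroupMonomial k hm} := by
    rw [mem_span_semigroupMonomial_iff]
    intro h
    obtain ⟨y, hy, h⟩ := h w (by rw [coe_semigroupMonomial, PowerSeries.coeff_X_pow_self]; simp)
    exact hwm y hy h
  refine ⟨fun hmax => hnot ?_, fun I J hIJ => ?_⟩
  · rw [isMax_iff_eq_top.1 hmax]
    trivial
  · by_contra! hcon
    have hI := lt_of_le_of_ne (hIJ ▸ inf_le_left) hcon.1.symm
    have hJ := lt_of_le_of_ne (hIJ ▸ inf_le_right) hcon.2.symm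
    refine hnot (hIJ ▸ ⟨?_, ?_⟩)
    · exact semigroupMonomial_mem_of_lt hm hw hsymm hI
    · exact semigroupMonomial_mem_of_lt hm hw hsymm hJ

end SemigroupRing

/-! ### The Hilbert function as a count of exponents -/

open IsLocalRing in
/-- The Hilbert function of a local `k`-algebra with residue field `k`, computed from a
presentation of `𝔪 ^ n / 𝔪 ^ (n + 1)` as a coordinate space over `k`. -/
theorem hilbertFunction_eq_card_of_surjective {k R : Type u} [Field k] [CommRing R]
    [IsLocalRing R] [Algebra k R]
    (hk : Function.Surjective ((Ideal.Quotient.mk (maximalIdeal R)).comp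
      (algebraMap k R)))
    {n : ℕ} {D : Finset ℕ} (φ : ↥(maximalIdeal R ^ n) →ₗ[k] (D → k))
    (hφ : Function.Surjective φ)
    (hker : ∀ f, φ f = 0 ↔ (f : R) ∈ maximalIdeal R ^ (n + 1)) :
    hilbertFunction R n = D.card := by
  set N : Submodule R ↥(maximalIdeal R ^ n) := maximalIdeal R • ⊤ with hN
  have hkerN : N.restrictScalars k = LinearMap.ker φ := by
    ext f
    rw [Submodule.restrictScalars_mem, hN, Submodule.mem_smul_top_iff, smul_eq_mul, ← pow_succ',
      LinearMap.mem_ker, hker]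
  let j : (↥(maximalIdeal R ^ n) ⧸ N) ≃ₗ[k] (D → k) :=
    (Submodule.Quotient.restrictScalarsEquiv k N).symm.trans
      ((Submodule.quotEquivOfEq _ _ hkerN).trans (φ.quotKerEquivOfSurjective hφ))
  have hrank := rank_eq_of_equiv_equiv (R := k) (R' := R ⧸ maximalIdeal R)
    ((Ideal.Quotient.mk (maximalIdeal R)).comp (algebraMap k R)) j.symm.toAddEquiv
    ⟨RingHom.injective _, hk⟩ fun r w => by
      obtain ⟨v, rfl⟩ := j.surjective w
      obtain ⟨f, rfl⟩ := Submodule.Quotient.mk_surjective _ v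
      change j.symm (r • j _) = _ • j.symm (j _)
      rw [← map_smul, j.symm_apply_apply, j.symm_apply_apply]
      change _ = Submodule.Quotient.mk (algebraMap k R r • f)
      rw [algebraMap_smul]
      rfl
  change Cardinal.toNat (Module.rank (R ⧸ maximalIdeal R) (↥(maximalIdeal R ^ n) ⧸ N)) = _
  rw [← hrank]
  exact (Module.finrank_fintype_fun_eq_card k).trans (Fintype.card_coe D)

/-- If `𝔪 ^ n` and `𝔪 ^ (n + 1)` are the monomial ideals of `I` and `J`, then the monomials with
exponents in `I \ J` form a basis of `𝔪 ^ n / 𝔪 ^ (n + 1)`. -/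
theorem hilbertFunction_eq_card {k : Type*} [Field k] {Γ : AddSubmonoid ℕ} {I J : Set ℕ}
    {hI : ∀ a ∈ I, ∀ s ∈ Γ, a + s ∈ I} {hJ : ∀ a ∈ J, ∀ s ∈ Γ, a + s ∈ J} (hIΓ : I ⊆ Γ) {n : ℕ}
    (hn : IsLocalRing.maximalIdeal (semigroupRing k Γ) ^ n = monomialIdeal k Γ I hI)
    (hn' : IsLocalRing.maximalIdeal (semigroupRing k Γ) ^ (n + 1) = monomialIdeal k Γ J hJ)
    {D : Finset ℕ} (hD : (D : Set ℕ) = I \ J) :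
    hilbertFunction (semigroupRing k Γ) n = D.card := by
  classical
  have hmem : ∀ f : semigroupRing k Γ, f ∈ IsLocalRing.maximalIdeal (semigroupRing k Γ) ^ n ↔
      ∀ i, PowerSeries.coeff i (f : k⟦X⟧) ≠ 0 → i ∈ I := by
    intro f
    rw [hn]
    rfl
  refine hilbertFunction_eq_card_of_surjective (k := k) (fun x => ?_)
    { toFun := fun f i => PowerSeries.coeff (i : ℕ) ((f : semigroupRing k Γ) : k⟦X⟧)
      map_add' := fun f g => by
        ext i
        simp
      map_smul' := fun c f => by
        ext i
        exact PowerSeries.coeff_smul _ _ _ } (fun v => ?_) fun f => ?_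
  · obtain ⟨f, rfl⟩ := Ideal.Quotient.mk_surjective x
    refine ⟨PowerSeries.constantCoeff (f : k⟦X⟧), ?_⟩
    rw [RingHom.comp_apply, Ideal.Quotient.mk_eq_mk_iff_sub_mem, mem_maximalIdeal_semigroupRing,
      AddSubgroupClass.coe_sub, map_sub, sub_eq_zero]
    exact PowerSeries.constantCoeff_C _
  · have h1 : ∀ i, PowerSeries.coeff i
        (PowerSeries.mk fun i => if h : i ∈ D then v ⟨i, h⟩ else 0) ≠ 0 → i ∈ I := by
      intro i hi
      rw [PowerSeries.coeff_mk] at hi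
      by_cases h : i ∈ D
      · exact (hD.subset h).1
      · rw [dif_neg h] at hi
        exact absurd rfl hi
    refine ⟨⟨⟨_, fun i hi => hIΓ (h1 i hi)⟩, (hmem _).2 h1⟩, ?_⟩
    ext i
    simp
  · rw [hn']
    constructor
    · intro h i h0
      by_contra hiJ
      have hiD : i ∈ D := hD.superset ⟨(hmem f).1 f.2 i h0, hiJ⟩
      exact h0 (congrFun h ⟨i, hiD⟩)
    · intro h
      ext i
      by_contra h0
      exact (hD.subset i.2).2 (h i h0)

section SymmetricClass

variable {e q d : ℕ}

theorem mem_symmetricClass_succ (he : 2 ≤ e) (hd : 0 < d) {x : ℕ}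
    (hx : x ∈ symmetricClass e q d) (hx0 : x ≠ 0) :
    ∃ s ∈ symmetricGenerators e q d, ∃ y ∈ symmetricClass e q d, x = s + y := by
  simp_rw [mem_symmetricClass_iff he hd] at hx ⊢
  exact exists_generator_of_mem_orderSet he (orderSet_one hx hx0)

/-- The set `orderSet e q d n` is the set of exponents of `𝔪 ^ n`. -/
theorem maximalIdeal_pow (k : Type*) [Field k] (he : 2 ≤ e) (hd : 0 < d) (n : ℕ) :
    IsLocalRing.maximalIdeal (semigroupRing k (symmetricClass e q d)) ^ n =
      monomialIdeal k (symmetricClass e q d) (orderSet e q d n)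
        fun _ ha _ hs => add_mem_orderSet he hd ha hs := by
  have hsub : ∀ n, orderSet e q d n ⊆ symmetricClass e q d := fun n x hx =>
    (mem_symmetricClass_iff he hd).2 (orderSet_antitone e q d n.zero_le hx)
  induction n with
  | zero =>
    rw [pow_zero, Ideal.one_eq_top]
    refine (eq_top_iff.2 fun f _ => ?_).symm
    exact fun n hn => (mem_symmetricClass_iff he hd).1 (f.2 n hn)
  | succ n ih =>
    rw [pow_succ', ih]
    refine le_antisymm (Ideal.mul_le.2 fun f hf g hg i hi => ?_) fun f hf => ?_
    · rw [MulMemClass.coe_mul, PowerSeries.coeff_mul] at hi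
      obtain ⟨p, hp, hne⟩ := Finset.exists_ne_zero_of_sum_ne_zero hi
      rw [← Finset.HasAntidiagonal.mem_antidiagonal.mp hp]
      have hp1 : p.1 ≠ 0 := by
        intro h0
        rw [mem_maximalIdeal_semigroupRing] at hf
        exact left_ne_zero_of_mul hne
          (by rwa [h0, PowerSeries.coeff_zero_eq_constantCoeff_apply])
      obtain ⟨s, hs, y, hy, hsy⟩ :=
        mem_symmetricClass_succ he hd (f.2 _ (left_ne_zero_of_mul hne)) hp1
      have h2 := add_mem_orderSet he hd (hg _ (right_ne_zero_of_mul hne)) hy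
      rw [hsy, add_assoc, add_comm y]
      exact generator_add_mem_orderSet he hd hs h2
    · refine mem_maximalIdeal_mul (S := (symmetricGenerators_finite e q d).toFinset)
        (fun s hs => ?_) _ (hsub n) fun i hi => ?_
      · rw [Set.Finite.mem_toFinset] at hs
        exact ⟨generator_mem_symmetricClass hs, (pos_of_mem_symmetricGenerators hs).ne'⟩
      · simp_rw [Set.Finite.mem_toFinset]
        exact exists_generator_of_mem_orderSet he (hf i hi)

theorem hilbertFunction_symmetricClass (k : Type*) [Field k] (he : 2 ≤ e) (hd : 0 < d)
    (hmd : Nat.gcd (e + 2 * q + 1) d = 1) (n : ℕ) :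
    hilbertFunction (semigroupRing k (symmetricClass e q d)) n =
      min (n + 1) (e + 2 * q + 1) +
        (if n = 0 then 0 else min (e + q - n) (e - 2)) := by
  obtain ⟨D, hD, hcard⟩ := exists_finset_orderSet_diff (n := n) he hmd
  rw [hilbertFunction_eq_card
    (fun x hx => (mem_symmetricClass_iff he hd).2 (orderSet_antitone e q d n.zero_le hx))
    (maximalIdeal_pow k he hd n) (maximalIdeal_pow k he hd (n + 1)) hD, hcard, card_orderIndices]

theorem isGorensteinOfDimOne_symmetricClass (k : Type*) [Field k] (he : 2 ≤ e) (hd : 0 < d)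
    (hmd : Nat.gcd (e + 2 * q + 1) d = 1) :
    IsGorensteinOfDimOne (semigroupRing k (symmetricClass e q d)) := by
  obtain ⟨c, hc⟩ := exists_conductor he hd hmd
  have hm : e + 2 * q + 1 ∈ symmetricClass e q d :=
    generator_mem_symmetricClass (Or.inl (Or.inl rfl))
  refine ⟨isNoetherianRing_semigroupRing hc (S := (symmetricGenerators_finite e q d).toFinset)
    (fun s hs => ?_) (fun n hn hn0 => ?_), ringKrullDim_semigroupRing hc,
    semigroupMonomial k hm, semigroupMonomial_mem_maximalIdeal hm (by omega),
    mem_nonZeroDivisors_of_ne_zero fun h => ?_,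
    infIrred_span_semigroupMonomial hm (aperyMax_mem he hd)
      (fun y hy => aperyMax_ne_add he hd hmd hy) fun x hx => exists_add_eq_aperyMax he hd hx⟩
  · rw [Set.Finite.mem_toFinset] at hs
    exact ⟨generator_mem_symmetricClass hs, (pos_of_mem_symmetricGenerators hs).ne'⟩
  · simp_rw [Set.Finite.mem_toFinset]
    exact mem_symmetricClass_succ he hd hn hn0
  · exact pow_ne_zero _ (PowerSeries.X_ne_zero (R := k)) (congrArg Subtype.val h)

end SymmetricClass

/-! ### The Hilbert series -/

theorem coeff_sum_Icc_C_mul_X_pow (c : ℕ → ℤ) (a b n : ℕ) :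
    PowerSeries.coeff n (∑ i ∈ Finset.Icc a b, PowerSeries.C (c i) * PowerSeries.X ^ i) =
      if a ≤ n ∧ n ≤ b then c n else 0 := by
  simp_rw [map_sum, PowerSeries.coeff_C_mul_X_pow]
  rw [Finset.sum_ite_eq]
  simp_rw [Finset.mem_Icc]

/-- A series that is eventually constant, multiplied by `1 - X`. -/
theorem mk_ite_mul_one_sub_X (c : ℤ) (N : ℕ) :
    (PowerSeries.mk fun n => if N ≤ n then c else 0) * (1 - PowerSeries.X) =
      PowerSeries.C c * PowerSeries.X ^ N := by
  ext n
  rw [PowerSeries.coeff_C_mul_X_pow, mul_sub, mul_one, map_sub, PowerSeries.coeff_mk]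
  cases n with
  | zero =>
    rw [PowerSeries.coeff_zero_mul_X, sub_zero]
    exact if_congr (by omega) rfl rfl
  | succ n =>
    rw [PowerSeries.coeff_succ_mul_X, PowerSeries.coeff_mk]
    split_ifs <;> omega

theorem theorem3p5 (k : Type*) [Field k] (e q d m : ℕ) (he : 4 ≤ e) (hq : 0 < q) (hd : 0 < d)
    (hm : m = e + 2 * q + 1) (hmd : Nat.gcd m d = 1) :
    -- the ring is of the kind considered in Rossi's conjecture
    IsGorensteinOfDimOne (semigroupRing k (symmetricClass e q d)) ∧
    -- its Hilbert function is non-decreasing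
    Monotone (hilbertFunction (semigroupRing k (symmetricClass e q d))) ∧
    -- the values of the Hilbert function
    hilbertFunction (semigroupRing k (symmetricClass e q d)) 0 = 1 ∧
    (∀ n, 1 ≤ n → n ≤ q + 1 →
      hilbertFunction (semigroupRing k (symmetricClass e q d)) n = e + (n - 1)) ∧
    (∀ n, q + 2 ≤ n → n ≤ e + q →
      hilbertFunction (semigroupRing k (symmetricClass e q d)) n = e + q + 1) ∧
    (∀ n, e + q + 1 ≤ n → n ≤ m - 2 →
      hilbertFunction (semigroupRing k (symmetricClass e q d)) n = n + 1) ∧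
    (∀ n, m - 1 ≤ n →
      hilbertFunction (semigroupRing k (symmetricClass e q d)) n = m) ∧
    -- the Hilbert series
    hilbertSeries (semigroupRing k (symmetricClass e q d)) * (1 - PowerSeries.X) =
      (1 + (∑ i ∈ Finset.Icc 1 (q + 1), ((e : ℤ⟦X⟧) + (i : ℤ⟦X⟧) - 1) * PowerSeries.X ^ i)
        + (∑ i ∈ Finset.Icc (q + 2) (e + q), ((e : ℤ⟦X⟧) + (q : ℤ⟦X⟧) + 1) * PowerSeries.X ^ i)
        + (∑ i ∈ Finset.Icc (e + q + 1) (m - 2), ((i : ℤ⟦X⟧) + 1) * PowerSeries.X ^ i))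
          * (1 - PowerSeries.X)
        + (m : ℤ⟦X⟧) * PowerSeries.X ^ (m - 1) := by
  subst hm
  have he2 : 2 ≤ e := by omega
  have hH := hilbertFunction_symmetricClass k he2 hd hmd
  refine ⟨isGorensteinOfDimOne_symmetricClass k he2 hd hmd, monotone_nat_of_le_succ fun n => ?_,
    ?_, fun n h1 h2 => ?_, fun n h1 h2 => ?_, fun n h1 h2 => ?_, fun n h1 => ?_, ?_⟩
  · rw [hH, hH, if_neg n.succ_ne_zero]
    rcases Nat.eq_zero_or_pos n with rfl | hn
    · rw [if_pos rfl]
      omega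
    · rw [if_neg hn.ne']
      omega
  · rw [hH, if_pos rfl]
    omega
  · rw [hH, if_neg (by omega)]
    omega
  · rw [hH, if_neg (by omega)]
    omega
  · rw [hH, if_neg (by omega)]
    omega
  · rw [hH]
    split_ifs <;> omega
  · have hC1 : ∀ i : ℕ, (e : ℤ⟦X⟧) + (i : ℤ⟦X⟧) - 1 = PowerSeries.C ((e : ℤ) + i - 1) := by simp
    have hC2 : (e : ℤ⟦X⟧) + (q : ℤ⟦X⟧) + 1 = PowerSeries.C ((e : ℤ) + q + 1) := by simp
    have hC3 : ∀ i : ℕ, (i : ℤ⟦X⟧) + 1 = PowerSeries.C ((i : ℤ) + 1) := by simp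
    have hC4 : ((e + 2 * q + 1 : ℕ) : ℤ⟦X⟧) = PowerSeries.C ((e + 2 * q + 1 : ℕ) : ℤ) := by simp
    simp_rw [hC1, hC2, hC3]
    rw [hC4, ← mk_ite_mul_one_sub_X, ← add_mul]
    congr 1
    ext n
    rw [hilbertSeries, PowerSeries.coeff_mk, hH, map_add, map_add, map_add, map_add,
      coeff_sum_Icc_C_mul_X_pow (fun i => (e : ℤ) + i - 1),
      coeff_sum_Icc_C_mul_X_pow (fun _ => (e : ℤ) + q + 1),
      coeff_sum_Icc_C_mul_X_pow (fun i => (i : ℤ) + 1), PowerSeries.coeff_mk,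
      PowerSeries.coeff_one]
    split_ifs <;> omega
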